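/- Let $n\ge 1$. Let $\mathfrak e_{D_{2n+1}}$ be the electrical Lie algebra of type $D_{2n+1}$, that is, the complex Lie algebra generated by $e_{\bar 1},e_1,e_2,\dots,e_{2n}$ subject to the relations $$[e_i,[e_i,e_j]]=-2e_i \ \text{ if } i \text{ and } j \text{ are adjacent},\qquad [e_i,e_j]=0\ \text{ if } i\neq j \text{ are not adjacent},$$ where $i,j$ are nodes of the Dynkin diagram $D_{2n+1}$, whose edges are $\{\bar 1,2\}$ and $\{k,k+1\}$ for $1\le k\le 2n-1$ (for $n=1$ this is the diagram $D_3=A_3$). Let $J$ be the ideal of $\mathfrak e_{D_{2n+1}}$ generated by $e_{\bar 1}-e_1$. Then $J$ is the radical of $\mathfrak e_{D_{2n+1}}$, i.e. its largest solvable ideal. Furthermore, $\mathfrak e_{D_{2n+1}}/J\cong\mathfrak{sp}_{2n}$, the symplectic Lie algebra of complex $2n\times 2n$ matrices. -/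

import Mathlib

noncomputable section

namespace Electrical

variable (R : Type*) [CommRing R] {ι : Type*}

/-- The relator attached to an ordered pair of nodes `i`, `j` of a Dynkin diagram with Cartan
matrix `A`. It expresses `ad(e_i)^(1 - a_ij) (e_j) = -2 e_i` if `a_ij = -1`, and
`ad(e_i)^(1 - a_ij) (e_j) = 0` otherwise. -/
def relator (A : Matrix ι ι ℤ) (i j : ι) : FreeLieAlgebra R ι :=
  ((LieAlgebra.ad R (FreeLieAlgebra R ι) (FreeLieAlgebra.of R i)) ^ (1 - A i j).toNat)
      (FreeLieAlgebra.of R j) -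
    (if A i j = -1 then (-2 : R) • FreeLieAlgebra.of R i else 0)

/-- The ideal of the free Lie algebra on the nodes that is generated by the electrical Serre
relators of all pairs of distinct nodes. -/
def relatorIdeal (A : Matrix ι ι ℤ) : LieIdeal R (FreeLieAlgebra R ι) :=
  LieSubmodule.lieSpan R (FreeLieAlgebra R ι) {x | ∃ i j : ι, i ≠ j ∧ x = relator R A i j}

/-- The electrical Lie algebra over `R` of a Dynkin diagram with Cartan matrix `A`. -/
abbrev ElectricalLieAlgebra (A : Matrix ι ι ℤ) : Type _ :=
  FreeLieAlgebra R ι ⧸ relatorIdeal R A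

/-- The generator `e_i` of the electrical Lie algebra. -/
def gen (A : Matrix ι ι ℤ) (i : ι) : ElectricalLieAlgebra R A :=
  LieSubmodule.Quotient.mk (FreeLieAlgebra.of R i)

/-- The complex electrical Lie algebra of type `D` and rank `2n + 1`. -/
abbrev eD (n : ℕ) : Type := ElectricalLieAlgebra ℂ (CartanMatrix.D (2 * n + 1))

/-- The generator `e_1` of one of the two end nodes of the fork of the diagram. In
`CartanMatrix.D (2 * n + 1)` the nodes are `0, 1, …, 2n`, and for `1 ≤ n` the end nodes of the fork
are `2n - 1` and `2n`, both joined to `2n - 2`. -/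
def eOne (n : ℕ) : eD n := gen ℂ (CartanMatrix.D (2 * n + 1)) ⟨2 * n - 1, by omega⟩

/-- The generator `e_{\bar 1}` of the other end node of the fork of the diagram. -/
def eOneBar (n : ℕ) : eD n := gen ℂ (CartanMatrix.D (2 * n + 1)) ⟨2 * n, by omega⟩

/-- The ideal `J` generated by `e_{\bar 1} - e_1`. -/
def J (n : ℕ) : LieIdeal ℂ (eD n) :=
  LieSubmodule.lieSpan ℂ (eD n) {eOneBar n - eOne n}

end Electrical

end

/-! Write `f` for the generator at one fork end and `e 0, …, e (2n - 1)` for the others, numbered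
away from the other fork end; passing to the quotient by `J` identifies `f` with `e 0` and leaves a
chain of type A.

Solvability of `J`: put `w 0 = f - e 0` and `w (j + 1) = [e (j + 1), w j]`. The generators map each
`w j` into the subalgebra generated by the `w`'s (`lie_forkVector_mem`), so this subalgebra contains
`J`. The element `[w 0, w 1]` commutes with every `w j` (`lie_lie_forkVector`), and every `[w 0, w
j]` lies in the ideal `P` it generates. Hence `[J, J] ≤ P` and `[J, P] = 0`.

The quotient: the chain relations alone leave at most `n(2n + 1)` spanning iterated brackets
(`span_chainBracket_eq_top`). In the symplectic algebra, viewed as symmetric products of vectors,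
suitable multiples of squares `v_i v_i` satisfy the same relations when the Gram matrix of the basis
`v_i` is tridiagonal. The iterated brackets then map to nonzero multiples of the independent
products `v_i v_j`, so the map is bijective (`bijective_of_isChain`).

The radical: the symplectic algebra has no nonzero abelian ideal, so every solvable ideal maps to
zero there and lies in `J`. -/

namespace Electrical

/-! ### Stability under generators. -/

section Generation

variable {K L : Type*} [CommRing K] [LieRing L] [LieAlgebra K L]

theorem lie_mem_of_mem_span {s : Set L} {S : Submodule K L} {x y : L}
    (h : ∀ z ∈ s, ⁅x, z⁆ ∈ S) (hy : y ∈ Submodule.span K s) : ⁅x, y⁆ ∈ S := by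
  induction hy using Submodule.span_induction with
  | mem z hz => exact h z hz
  | zero => simp
  | add u v _ _ hu hv => rw [lie_add]; exact S.add_mem hu hv
  | smul t u _ hu => rw [lie_smul]; exact S.smul_mem t hu

/-- A submodule that is stable under the adjoint action of a set of generators of a Lie algebra is
stable under the adjoint action of the whole Lie algebra. -/
theorem lie_mem_of_lieSpan_eq_top {G : Set L} (hG : LieSubalgebra.lieSpan K L G = ⊤)
    (S : Submodule K L) (hS : ∀ g ∈ G, ∀ y ∈ S, ⁅g, y⁆ ∈ S) (x : L) {y : L} (hy : y ∈ S) :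
    ⁅x, y⁆ ∈ S := by
  have hx : x ∈ LieSubalgebra.lieSpan K L G := hG ▸ LieSubalgebra.mem_top x
  induction hx using LieSubalgebra.lieSpan_induction generalizing y with
  | mem g hg => exact hS g hg y hy
  | zero => simp
  | add u v _ _ hu hv => rw [add_lie]; exact S.add_mem (hu hy) (hv hy)
  | smul t u _ hu => rw [smul_lie]; exact S.smul_mem t (hu hy)
  | lie u v _ _ hu hv => rw [lie_lie]; exact S.sub_mem (hu (hv hy)) (hv (hu hy))

/-- A submodule that contains a set of generators of a Lie algebra and is stable under their adjoint
action is everything. -/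
theorem eq_top_of_lie_mem {G : Set L} (hG : LieSubalgebra.lieSpan K L G = ⊤)
    (S : Submodule K L) (hGS : G ⊆ S) (hS : ∀ g ∈ G, ∀ y ∈ S, ⁅g, y⁆ ∈ S) : S = ⊤ := by
  have key : LieSubalgebra.lieSpan K L G ≤
      { S with lie_mem' := fun {x _} _ hy => lie_mem_of_lieSpan_eq_top hG S hS x hy } :=
    LieSubalgebra.lieSpan_le.2 hGS
  rw [hG] at key
  exact eq_top_iff.2 fun x _ => key (LieSubalgebra.mem_top x)

/-- A Lie subalgebra is stable under the adjoint action of the whole Lie algebra as soon as this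
holds for generators of the Lie algebra and of the subalgebra. -/
theorem lie_mem_lieSpan {G : Set L} (hG : LieSubalgebra.lieSpan K L G = ⊤) (T : Set L)
    (hT : ∀ g ∈ G, ∀ y ∈ T, ⁅g, y⁆ ∈ LieSubalgebra.lieSpan K L T) (x : L) {y : L}
    (hy : y ∈ LieSubalgebra.lieSpan K L T) : ⁅x, y⁆ ∈ LieSubalgebra.lieSpan K L T := by
  refine lie_mem_of_lieSpan_eq_top hG (LieSubalgebra.lieSpan K L T).toSubmodule ?_ x hy
  intro g hg y hy
  simp only [LieSubalgebra.mem_toSubmodule] at hy ⊢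
  induction hy using LieSubalgebra.lieSpan_induction with
  | mem y hy => exact hT g hg y hy
  | zero => simp
  | add u v _ _ hu hv => rw [lie_add]; exact add_mem hu hv
  | smul t u _ hu => rw [lie_smul]; exact SMulMemClass.smul_mem t hu
  | lie u v hu' hv' hu hv =>
    rw [leibniz_lie]
    exact add_mem (LieSubalgebra.lie_mem _ hu hv') (LieSubalgebra.lie_mem _ hu' hv)

end Generation

/-- Turns a relation `[b, [b, a]] = -2b` into an identity between operators applied to `z`; the
later computations choose `z` so that most terms vanish. -/
theorem lie_lie_lie_apply {L : Type*} [LieRing L] (b a z : L) :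
    ⁅⁅b, ⁅b, a⁆⁆, z⁆ =
      ⁅b, ⁅b, ⁅a, z⁆⁆⁆ - ⁅b, ⁅a, ⁅b, z⁆⁆⁆ - ⁅b, ⁅a, ⁅b, z⁆⁆⁆ + ⁅a, ⁅b, ⁅b, z⁆⁆⁆ := by
  simp only [lie_lie, lie_sub]
  abel

/-- The electrical relations of type `A_N` for the elements `e 0, …, e (N - 1)`. -/
structure IsChain (K : Type*) {L : Type*} [CommRing K] [LieRing L] [LieAlgebra K L]
    (N : ℕ) (e : ℕ → L) : Prop where
  lie_lie_succ : ∀ i, i + 1 < N → ⁅e i, ⁅e i, e (i + 1)⁆⁆ = (-2 : K) • e i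
  lie_lie_pred : ∀ i, i + 1 < N → ⁅e (i + 1), ⁅e (i + 1), e i⁆⁆ = (-2 : K) • e (i + 1)
  lie_eq_zero : ∀ i j, i + 1 < j → j < N → ⁅e i, e j⁆ = 0

/-- The iterated bracket `[e i, [e (i + 1), …, e (i + d)]]`. -/
def chainBracket {L : Type*} [LieRing L] (e : ℕ → L) : ℕ → ℕ → L
  | i, 0 => e i
  | i, d + 1 => ⁅e i, chainBracket e (i + 1) d⁆

/-! ### Type A: a spanning set of iterated brackets. -/

namespace IsChain

variable {K L : Type*} [Field K] [LieRing L] [LieAlgebra K L] {N : ℕ} {e : ℕ → L}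

theorem lie_eq_zero' (h : IsChain K N e) {i j : ℕ} (hij : i + 1 < j) (hj : j < N) :
    ⁅e j, e i⁆ = 0 := by
  rw [← lie_skew, h.lie_eq_zero i j hij hj, neg_zero]

theorem lie_chainBracket_far (h : IsChain K N e) (k : ℕ) :
    ∀ d i, k + 1 < i → i + d < N → ⁅e k, chainBracket e i d⁆ = 0
  | 0, i, hk, hi => h.lie_eq_zero k i hk hi
  | d + 1, i, hk, hi => by
    rw [chainBracket, leibniz_lie, h.lie_eq_zero k i hk (by omega),
      h.lie_chainBracket_far k d (i + 1) (by omega) (by omega)]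
    simp

/-- The tail `z` starting at `i + 2` commutes with `e i`, so two applications of `e i` to `[e (i +
1), z]` act only on `e (i + 1)` and give `-2 [e i, z] = 0`. -/
theorem lie_chainBracket_self (h : IsChain K N e) (i d : ℕ) (hi : i + (d + 2) < N) :
    ⁅e i, chainBracket e i (d + 2)⁆ = 0 := by
  have h0 := h.lie_chainBracket_far i d (i + 2) (by omega) (by omega)
  have h1 := h.lie_lie_succ i (by omega)
  rw [chainBracket, chainBracket, leibniz_lie (e i) (e (i + 1)), h0, lie_zero, add_zero,
    leibniz_lie, h1, h0]
  simp [h0]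

theorem lie_succ_chainBracket_one (h : IsChain K N e) (i : ℕ) (hi : i + 1 < N) :
    ⁅e (i + 1), chainBracket e i 1⁆ = (2 : K) • e (i + 1) := by
  rw [chainBracket, chainBracket, ← lie_skew (e i), lie_neg, h.lie_lie_pred i hi]
  module

theorem two_smul_lie_succ_chainBracket (h : IsChain K N e) (i d : ℕ) (hi : i + (d + 2) < N) :
    (2 : K) • ⁅e (i + 1), chainBracket e i (d + 2)⁆ =
      (2 : K) • chainBracket e (i + 1) (d + 1) +
        ⁅e i, ⁅e (i + 1), chainBracket e (i + 1) (d + 1)⁆⁆ := by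
  have h0 := h.lie_chainBracket_far i d (i + 2) (by omega) (by omega)
  have key := lie_lie_lie_apply (e (i + 1)) (e i) (chainBracket e (i + 2) d)
  rw [h.lie_lie_pred i (by omega), h0, lie_zero, lie_zero, smul_lie] at key
  simp only [chainBracket]
  linear_combination (norm := module) key

variable [CharZero K]

theorem lie_succ_chainBracket_two (h : IsChain K N e) (i : ℕ) (hi : i + 2 < N) :
    ⁅e (i + 1), chainBracket e i 2⁆ = chainBracket e (i + 1) 1 - chainBracket e i 1 := by
  have h1 := h.two_smul_lie_succ_chainBracket i 0 hi
  have h2 : ⁅e (i + 1), chainBracket e (i + 1) 1⁆ = (-2 : K) • e (i + 1) :=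
    h.lie_lie_succ (i + 1) hi
  rw [zero_add, h2, lie_smul] at h1
  refine smul_right_injective L (two_ne_zero (α := K)) ?_
  simp only [zero_add] at h1 ⊢
  rw [h1]
  simp only [chainBracket]
  module

theorem lie_succ_chainBracket (h : IsChain K N e) (i d : ℕ) (hi : i + (d + 3) < N) :
    ⁅e (i + 1), chainBracket e i (d + 3)⁆ = chainBracket e (i + 1) (d + 2) := by
  have h1 := h.two_smul_lie_succ_chainBracket i (d + 1) hi
  rw [h.lie_chainBracket_self (i + 1) d (by omega), lie_zero, add_zero] at h1
  exact smul_right_injective L (two_ne_zero (α := K)) h1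

/-- Keeping the starting index `i` in the span makes the induction close: `e k` commutes with `e i`,
so it acts on the bracket starting at `i + 1`, and `e i` is applied afterwards. -/
theorem lie_mem_span_of_add_two_le (h : IsChain K N e) :
    ∀ d i k, i + 2 ≤ k → k < N → i + d < N →
      ⁅e k, chainBracket e i d⁆ ∈
        Submodule.span K {x | ∃ d', i + d' < N ∧ x = chainBracket e i d'}
  | 0, i, k, hk, hkN, _ => by
    rw [chainBracket, h.lie_eq_zero' hk hkN]
    exact zero_mem _
  | d + 1, i, k, hk, hkN, hi => by
    have hmem : ∀ d', i + d' < N → chainBracket e i d' ∈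
        Submodule.span K {x | ∃ d', i + d' < N ∧ x = chainBracket e i d'} :=
      fun d' hd' => Submodule.subset_span ⟨d', hd', rfl⟩
    have hik : ⁅e k, e i⁆ = 0 := h.lie_eq_zero' hk hkN
    rw [chainBracket, leibniz_lie, hik, zero_lie, zero_add]
    rcases Nat.lt_or_ge (i + 2) k with hk' | hk'
    · have := h.lie_mem_span_of_add_two_le d (i + 1) k hk' hkN (by omega)
      refine lie_mem_of_mem_span ?_ this
      rintro _ ⟨d', hd', rfl⟩
      exact hmem (d' + 1) (by omega)
    -- Here `e k` is adjacent to the next start `i + 1`, so the explicit formulas replace the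
    -- induction; any term starting at `i + 2` is then killed by `e i`.
    · obtain rfl : k = i + 2 := by omega
      have h0 : ⁅e i, e (i + 2)⁆ = 0 := h.lie_eq_zero i (i + 2) (by omega) hkN
      match d, hi with
      | 0, hi =>
        have : ⁅e (i + 2), chainBracket e (i + 1) 0⁆ = -chainBracket e (i + 1) 1 := by
          rw [chainBracket, chainBracket, chainBracket, lie_skew]
        rw [this, lie_neg]
        exact neg_mem (hmem 2 (by omega))
      | 1, hi =>
        rw [h.lie_succ_chainBracket_one (i + 1) hkN, lie_smul, h0, smul_zero]
        exact zero_mem _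
      | 2, hi =>
        rw [h.lie_succ_chainBracket_two (i + 1) (by omega), lie_sub,
          h.lie_chainBracket_far i 1 (i + 2) (by omega) (by omega), zero_sub]
        exact neg_mem (hmem 2 (by omega))
      | d + 3, hi =>
        rw [h.lie_succ_chainBracket (i + 1) d (by omega),
          h.lie_chainBracket_far i (d + 2) (i + 2) (by omega) (by omega)]
        exact zero_mem _

theorem lie_chainBracket_mem_span (h : IsChain K N e) (d i k : ℕ) (hk : k < N) (hi : i + d < N) :
    ⁅e k, chainBracket e i d⁆ ∈
      Submodule.span K {x | ∃ i d, i + d < N ∧ x = chainBracket e i d} := by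
  have hmem : ∀ i d, i + d < N → chainBracket e i d ∈
      Submodule.span K {x | ∃ i d, i + d < N ∧ x = chainBracket e i d} :=
    fun i d hd => Submodule.subset_span ⟨i, d, hd, rfl⟩
  rcases lt_trichotomy (k + 1) i with hki | rfl | hki
  · rw [h.lie_chainBracket_far k d i hki hi]
    exact zero_mem _
  · exact hmem k (d + 1) (by omega)
  rcases Nat.lt_or_ge (i + 1) k with hik | hik
  · refine Submodule.span_mono ?_ (h.lie_mem_span_of_add_two_le d i k hik hk hi)
    rintro x ⟨d', hd', rfl⟩
    exact ⟨i, d', hd', rfl⟩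
  obtain rfl | rfl : k = i ∨ k = i + 1 := by omega
  · match d, hi with
    | 0, hi =>
      rw [chainBracket, lie_self]
      exact zero_mem _
    | 1, hi =>
      rw [chainBracket, chainBracket, h.lie_lie_succ k hi]
      exact Submodule.smul_mem _ _ (hmem k 0 (by omega))
    | d + 2, hi =>
      rw [h.lie_chainBracket_self k d hi]
      exact zero_mem _
  · match d, hi with
    | 0, hi =>
      rw [chainBracket, ← lie_skew]
      exact neg_mem (hmem i 1 hk)
    | 1, hi =>
      rw [h.lie_succ_chainBracket_one i hi]
      exact Submodule.smul_mem _ _ (hmem (i + 1) 0 hi)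
    | 2, hi =>
      rw [h.lie_succ_chainBracket_two i hi]
      exact sub_mem (hmem (i + 1) 1 (by omega)) (hmem i 1 (by omega))
    | d + 3, hi =>
      rw [h.lie_succ_chainBracket i d hi]
      exact hmem (i + 1) (d + 2) (by omega)

/-- A Lie algebra generated by a chain of length `N` is spanned by the `N (N + 1) / 2` iterated
brackets of the chain. -/
theorem span_chainBracket_eq_top (h : IsChain K N e)
    (hgen : LieSubalgebra.lieSpan K L (e '' Set.Iio N) = ⊤) :
    Submodule.span K {x | ∃ i d, i + d < N ∧ x = chainBracket e i d} = ⊤ := by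
  refine eq_top_of_lie_mem hgen _ ?_ ?_
  · rintro _ ⟨i, hi, rfl⟩
    exact Submodule.subset_span ⟨i, 0, hi, rfl⟩
  · rintro _ ⟨k, hk, rfl⟩ y hy
    refine lie_mem_of_mem_span ?_ hy
    rintro _ ⟨i, d, hd, rfl⟩
    exact h.lie_chainBracket_mem_span d i k hk hd

end IsChain

end Electrical

/-! ### The fork: solvability of the ideal generated by the difference of its ends. -/

namespace Electrical

/-- The electrical relations of type `D_{N + 1}` for the elements `f, e 0, …, e (N - 1)`, where
`f` and `e 0` belong to the end nodes of the fork. -/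
structure IsFork (K : Type*) {L : Type*} [CommRing K] [LieRing L] [LieAlgebra K L]
    (N : ℕ) (e : ℕ → L) (f : L) : Prop where
  isChain : IsChain K N e
  lie_fork : ⁅e 0, f⁆ = 0
  lie_lie_right : 1 < N → ⁅f, ⁅f, e 1⁆⁆ = (-2 : K) • f
  lie_lie_left : 1 < N → ⁅e 1, ⁅e 1, f⁆⁆ = (-2 : K) • e 1
  lie_right : ∀ j, 1 < j → j < N → ⁅f, e j⁆ = 0

/-- The iterated bracket `[e j, [e (j - 1), …, [e 1, f - e 0]]]`. -/
def forkVector {L : Type*} [LieRing L] (e : ℕ → L) (f : L) : ℕ → L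
  | 0 => f - e 0
  | j + 1 => ⁅e (j + 1), forkVector e f j⁆

namespace IsFork

variable {K L : Type*} [Field K] [LieRing L] [LieAlgebra K L] {N : ℕ} {e : ℕ → L} {f : L}

local notation "w" => forkVector e f

theorem lie_fork' (h : IsFork K N e f) : ⁅f, e 0⁆ = 0 := by
  rw [← lie_skew, h.lie_fork, neg_zero]

theorem lie_right' (h : IsFork K N e f) {j : ℕ} (hj : 1 < j) (hjN : j < N) : ⁅e j, f⁆ = 0 := by
  rw [← lie_skew, h.lie_right j hj hjN, neg_zero]

theorem lie_forkVector_of_add_two_le (h : IsFork K N e f) {k : ℕ} (hk : k < N) :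
    ∀ j, j + 2 ≤ k → ⁅e k, w j⁆ = 0
  | 0, hj => by
    rw [forkVector, lie_sub, h.lie_right' hj hk, h.isChain.lie_eq_zero' hj hk, sub_zero]
  | j + 1, hj => by
    rw [forkVector, leibniz_lie, h.isChain.lie_eq_zero' (by omega) hk,
      h.lie_forkVector_of_add_two_le hk j (by omega), zero_lie, lie_zero, add_zero]

theorem lie_forkVector_self (h : IsFork K N e f) : ∀ j, j + 1 < N → ⁅e (j + 1), w (j + 1)⁆ = 0
  | 0, hj => by
    rw [forkVector, forkVector, zero_add, lie_sub, lie_sub, h.lie_lie_left hj,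
      h.isChain.lie_lie_pred 0 hj, sub_self]
  | j + 1, hj => by
    have h0 := h.lie_forkVector_of_add_two_le hj j le_rfl
    have key := lie_lie_lie_apply (e (j + 2)) (e (j + 1)) (w j)
    rw [h.isChain.lie_lie_pred (j + 1) hj, smul_lie, h0] at key
    simp only [lie_zero, smul_zero, sub_zero, add_zero] at key
    exact key.symm

theorem lie_forkVector_zero (h : IsFork K N e f) : ⁅e 0, w 0⁆ = 0 := by
  rw [forkVector, lie_sub, lie_self, h.lie_fork, sub_zero]

theorem lie_right_forkVector_zero (h : IsFork K N e f) : ⁅f, w 0⁆ = 0 := by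
  rw [forkVector, lie_sub, lie_self, h.lie_fork', sub_zero]

/-- The mixed terms `[e 0, [e 1, f]]` and `[f, [e 1, e 0]]` agree because `e 0` and `f` commute, so
they cancel. -/
theorem lie_add_forkVector_one (h : IsFork K N e f) (hN : 1 < N) :
    ⁅e 0 + f, w 1⁆ = (2 : K) • w 0 := by
  have h1 : ⁅e 0, ⁅e 1, e 0⁆⁆ = (2 : K) • e 0 := by
    rw [← lie_skew (e 1), lie_neg, h.isChain.lie_lie_succ 0 hN]
    module
  have h2 : ⁅f, ⁅e 1, f⁆⁆ = (2 : K) • f := by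
    rw [← lie_skew (e 1), lie_neg, h.lie_lie_right hN]
    module
  have h3 : ⁅e 0, ⁅e 1, f⁆⁆ = ⁅f, ⁅e 1, e 0⁆⁆ := by
    rw [leibniz_lie, h.lie_fork, lie_zero, add_zero, ← lie_skew, ← lie_skew (e 0), lie_neg,
      neg_neg]
  simp only [forkVector, lie_sub, add_lie, zero_add, h1, h2, h3]
  module

theorem lie_add_forkVector (h : IsFork K N e f) :
    ∀ j, j + 2 < N → ⁅e 0 + f, w (j + 2)⁆ = 0
  | 0, hj => by
    have h0 : ⁅e 0 + f, e 2⁆ = 0 := by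
      rw [add_lie, h.isChain.lie_eq_zero 0 2 (by omega) hj, h.lie_right 2 (by omega) hj, add_zero]
    rw [forkVector, leibniz_lie, h0, h.lie_add_forkVector_one (by omega), lie_smul,
      h.lie_forkVector_of_add_two_le hj 0 le_rfl]
    simp
  | j + 1, hj => by
    have h0 : ⁅e 0 + f, e (j + 3)⁆ = 0 := by
      rw [add_lie, h.isChain.lie_eq_zero 0 _ (by omega) hj, h.lie_right _ (by omega) hj, add_zero]
    rw [forkVector, leibniz_lie, h0, h.lie_add_forkVector j (by omega), zero_lie, lie_zero,
      add_zero]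

variable [CharZero K]

theorem lie_forkVector_succ (h : IsFork K N e f) (j : ℕ) (hj : j + 2 < N) :
    ⁅e (j + 1), w (j + 2)⁆ = w (j + 1) := by
  have h0 := h.lie_forkVector_of_add_two_le hj j le_rfl
  have h1 := h.lie_forkVector_self j (by omega)
  have key := lie_lie_lie_apply (e (j + 1)) (e (j + 2)) (w j)
  simp only [forkVector] at h1
  rw [h.isChain.lie_lie_succ (j + 1) hj, smul_lie, h0, h1] at key
  refine smul_right_injective L (two_ne_zero (α := K)) ?_
  simp only [forkVector, lie_zero] at key ⊢
  linear_combination (norm := module) key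

theorem lie_forkVector_far (h : IsFork K N e f) (j : ℕ) :
    ∀ d, j + d + 3 < N → ⁅e (j + 1), w (j + d + 3)⁆ = 0
  | 0, hd => by
    rw [forkVector, leibniz_lie, h.isChain.lie_eq_zero (j + 1) _ (by omega) hd, zero_lie, zero_add]
    rw [show j + 0 + 2 = j + 2 from rfl, h.lie_forkVector_succ j (by omega),
      h.lie_forkVector_of_add_two_le hd (j + 1) le_rfl]
  | d + 1, hd => by
    rw [forkVector, leibniz_lie, h.isChain.lie_eq_zero (j + 1) _ (by omega) hd, zero_lie, zero_add]
    have := h.lie_forkVector_far j d (by omega)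
    rw [show j + (d + 1) + 2 = j + d + 3 by omega, this, lie_zero]

/-- The generators `f` and `e 0` are half of `(e 0 + f) ± w 0`. The sum and all other `e k` preserve
the linear span of the `w`'s; only `w 0` requires the subalgebra they generate. -/
theorem lie_forkVector_mem (h : IsFork K N e f) (hN : 1 < N) {g : L}
    (hg : g ∈ insert f (e '' Set.Iio N)) {j : ℕ} (hj : j < N) :
    ⁅g, w j⁆ ∈ LieSubalgebra.lieSpan K L (w '' Set.Iio N) := by
  set T := LieSubalgebra.lieSpan K L (w '' Set.Iio N)
  have hw : ∀ i < N, w i ∈ T := fun i hi => LieSubalgebra.subset_lieSpan ⟨i, hi, rfl⟩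
  have hs : ⁅e 0 + f, w j⁆ ∈ T := by
    match j, hj with
    | 0, _ =>
      rw [add_lie, h.lie_forkVector_zero, h.lie_right_forkVector_zero, add_zero]
      exact T.zero_mem
    | 1, _ =>
      rw [h.lie_add_forkVector_one hN]
      exact T.smul_mem _ (hw 0 (by omega))
    | j + 2, hj =>
      rw [h.lie_add_forkVector j hj]
      exact T.zero_mem
  have hd : ⁅w 0, w j⁆ ∈ T := T.lie_mem (hw 0 (by omega)) (hw j hj)
  have h2 : (2 : K) ≠ 0 := two_ne_zero
  obtain rfl | ⟨k, hk, rfl⟩ := hg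
  · have : g = (2⁻¹ : K) • ((e 0 + g) + forkVector e g 0) := by
      rw [forkVector, add_comm (e 0) g, add_add_sub_cancel, ← two_smul K, smul_smul,
        inv_mul_cancel₀ h2, one_smul]
    have h3 : ⁅g, forkVector e g j⁆ =
        (2⁻¹ : K) • (⁅e 0 + g, forkVector e g j⁆ + ⁅forkVector e g 0, forkVector e g j⁆) := by
      rw [← add_lie, ← smul_lie, ← this]
    rw [h3]
    exact T.smul_mem _ (T.add_mem hs hd)
  rw [Set.mem_Iio] at hk
  match k, hk with
  | 0, _ =>
    have : e 0 = (2⁻¹ : K) • ((e 0 + f) - w 0) := by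
      rw [forkVector, add_comm (e 0) f, add_sub_sub_cancel, ← two_smul K, smul_smul,
        inv_mul_cancel₀ h2, one_smul]
    have h3 : ⁅e 0, w j⁆ = (2⁻¹ : K) • (⁅e 0 + f, w j⁆ - ⁅w 0, w j⁆) := by
      rw [← sub_lie, ← smul_lie, ← this]
    rw [h3]
    exact T.smul_mem _ (T.sub_mem hs hd)
  | k + 1, hk =>
    obtain hjk | rfl | rfl | rfl | ⟨d, rfl⟩ :
        j + 2 ≤ k + 1 ∨ j = k ∨ j = k + 1 ∨ j = k + 2 ∨ ∃ d, j = k + d + 3 := by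
      rcases Nat.lt_or_ge j (k + 3) with h | h
      · omega
      · exact Or.inr (Or.inr (Or.inr (Or.inr ⟨j - (k + 3), by omega⟩)))
    · rw [h.lie_forkVector_of_add_two_le hk j hjk]
      exact T.zero_mem
    · exact hw (j + 1) hk
    · rw [h.lie_forkVector_self k hk]
      exact T.zero_mem
    · rw [h.lie_forkVector_succ k hj]
      exact hw _ hk
    · rw [h.lie_forkVector_far k d hj]
      exact T.zero_mem

omit [CharZero K] in
-- Up to sign this is `ad (w 0)` cubed on `e 1`; already its square gives a combination of `e 0`,
-- `f` and `X`, all commuting with `w 0`.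
theorem lie_lie_forkVector_zero (h : IsFork K N e f) (hN : 1 < N) : ⁅w 0, ⁅w 0, w 1⁆⁆ = 0 := by
  set X := ⁅e 0, ⁅f, e 1⁆⁆ with hX
  have hX' : ⁅f, ⁅e 0, e 1⁆⁆ = X := by rw [leibniz_lie, h.lie_fork', zero_lie, zero_add]
  have h1 : ⁅w 0, ⁅w 0, e 1⁆⁆ = (-2 : K) • (e 0 + f + X) := by
    simp only [forkVector, lie_sub, sub_lie, h.lie_lie_right hN, hX', ← hX,
      h.isChain.lie_lie_succ 0 hN]
    module
  have h2 : ⁅w 0, X⁆ = 0 := by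
    have h3 : ⁅f, X⁆ = 0 := by
      rw [hX, leibniz_lie, h.lie_fork', h.lie_lie_right hN, lie_smul, h.lie_fork]
      simp
    have h4 : ⁅e 0, X⁆ = 0 := by
      rw [← hX', leibniz_lie, h.lie_fork, h.isChain.lie_lie_succ 0 hN, lie_smul, h.lie_fork']
      simp
    rw [forkVector, sub_lie, h3, h4, sub_zero]
  have h5 : ⁅w 0, ⁅w 0, ⁅w 0, e 1⁆⁆⁆ = 0 := by
    rw [h1, lie_smul, lie_add, lie_add, h2, ← lie_skew, h.lie_forkVector_zero, ← lie_skew (w 0),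
      h.lie_right_forkVector_zero]
    simp
  have h6 : w 1 = -⁅w 0, e 1⁆ := by
    rw [lie_skew]
    rfl
  rw [h6, lie_neg, lie_neg, h5, neg_zero]

omit [CharZero K] in
-- Apply `e 1`, which sends `w 0` to `w 1` and kills `w 1`, to the preceding identity.
theorem lie_lie_forkVector_one (h : IsFork K N e f) (hN : 1 < N) : ⁅w 1, ⁅w 0, w 1⁆⁆ = 0 := by
  have h1 := congrArg (fun u => ⁅e 1, u⁆) (h.lie_lie_forkVector_zero hN)
  have h2 : ⁅e 1, w 1⁆ = 0 := h.lie_forkVector_self 0 hN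
  have h3 : ⁅e 1, w 0⁆ = w 1 := rfl
  simpa only [leibniz_lie (e 1), h2, h3, lie_zero, lie_self, add_zero] using h1

theorem lie_lie_forkVector_two (h : IsFork K N e f) (hN : 2 < N) : ⁅w 2, ⁅w 0, w 1⁆⁆ = 0 := by
  have h20 : ⁅e 2, w 0⁆ = 0 := h.lie_forkVector_of_add_two_le hN 0 le_rfl
  have h21 : ⁅e 2, w 1⁆ = w 2 := rfl
  have h12 : ⁅e 1, w 2⁆ = w 1 := h.lie_forkVector_succ 0 hN
  have h10 : ⁅e 1, w 0⁆ = w 1 := rfl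
  have h1 := congrArg (fun u => ⁅e 2, u⁆) (h.lie_lie_forkVector_one (by omega))
  have h2 := congrArg (fun u => ⁅e 2, u⁆) (h.lie_lie_forkVector_zero (by omega))
  simp only [leibniz_lie (e 2), h20, h21, lie_zero, zero_lie, zero_add] at h1 h2
  have h3 := congrArg (fun u => ⁅e 1, u⁆) h2
  simp only [leibniz_lie (e 1), h10, h12, lie_zero, lie_add,
    h.lie_lie_forkVector_zero (by omega : 1 < N), add_zero] at h3
  have h4 := leibniz_lie (w 0) (w 1) (w 2)
  have h5 : ⁅⁅w 0, w 1⁆, w 2⁆ = -⁅w 2, ⁅w 0, w 1⁆⁆ := (lie_skew _ _).symm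
  rw [h5] at h4
  -- With `a = [w 2, [w 0, w 1]]`, `b = [w 1, [w 0, w 2]]`, `c = [w 0, [w 1, w 2]]`, the relations
  -- are `a + b = 0`, `b + c = 0` and, by Jacobi, `c = b - a`; together they give `3a = 0`.
  refine smul_right_injective L (three_ne_zero (α := K)) ?_
  simp only [smul_zero]
  linear_combination (norm := module) (2 : K) • h1 - h3 + h4

theorem lie_lie_forkVector (h : IsFork K N e f) (hN : 1 < N) :
    ∀ k, k < N → ⁅w k, ⁅w 0, w 1⁆⁆ = 0
  | 0, _ => h.lie_lie_forkVector_zero hN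
  | 1, _ => h.lie_lie_forkVector_one hN
  | 2, hk => h.lie_lie_forkVector_two hk
  | k + 3, hk => by
    have h0 := h.lie_forkVector_of_add_two_le hk 0 (by omega)
    have h1 := h.lie_forkVector_of_add_two_le hk 1 (by omega)
    have h2 := congrArg (fun u => ⁅e (k + 3), u⁆) (h.lie_lie_forkVector hN (k + 2) (by omega))
    simp only [leibniz_lie (e (k + 3)), h0, h1, zero_lie, lie_zero, add_zero] at h2
    exact h2

omit [CharZero K] in
theorem lie_forkVector_mem_lieSpan (h : IsFork K N e f) :
    ∀ j, j < N → ⁅w 0, w j⁆ ∈ LieSubmodule.lieSpan K L {⁅w 0, w 1⁆}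
  | 0, _ => by
    rw [lie_self]
    exact zero_mem _
  | 1, _ => LieSubmodule.subset_lieSpan rfl
  | j + 2, hj => by
    have h0 := h.lie_forkVector_of_add_two_le hj 0 (by omega)
    have h1 : ⁅w 0, w (j + 2)⁆ = ⁅e (j + 2), ⁅w 0, w (j + 1)⁆⁆ := by
      rw [leibniz_lie (e (j + 2)), h0, zero_lie, zero_add]
      rfl
    rw [h1]
    exact LieSubmodule.lie_mem _ (h.lie_forkVector_mem_lieSpan (j + 1) (by omega))

end IsFork

/-- If an element `y` is mapped into an ideal `P` by generators of a Lie subalgebra that contains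
an ideal `I`, then the bracket of `I` with the ideal generated by `y` lies in `P`. -/
theorem lie_lieSpan_singleton_le {K L : Type*} [CommRing K] [LieRing L] [LieAlgebra K L]
    {I P : LieIdeal K L} {T : Set L} (hI : ∀ x ∈ I, x ∈ LieSubalgebra.lieSpan K L T) {y : L}
    (hy : ∀ t ∈ T, ⁅t, y⁆ ∈ P) : ⁅I, LieSubmodule.lieSpan K L {y}⁆ ≤ P := by
  rw [LieSubmodule.lie_le_iff]
  intro x hx z hz
  induction hz using LieSubmodule.lieSpan_induction generalizing x with
  | mem z hz =>
    obtain rfl : z = y := hz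
    replace hx := hI x hx
    induction hx using LieSubalgebra.lieSpan_induction with
    | mem t ht => exact hy t ht
    | zero => simp
    | add u v _ _ hu hv => rw [add_lie]; exact add_mem hu hv
    | smul t u _ hu => rw [smul_lie]; exact SMulMemClass.smul_mem t hu
    | lie u v _ _ hu hv =>
      rw [lie_lie]
      exact sub_mem (LieSubmodule.lie_mem _ hv) (LieSubmodule.lie_mem _ hu)
  | zero => simp
  | add u v _ _ hu hv => rw [lie_add]; exact add_mem (hu x hx) (hv x hx)
  | smul t u _ hu => rw [lie_smul]; exact SMulMemClass.smul_mem t (hu x hx)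
  | lie u v _ hv =>
    rw [leibniz_lie]
    exact add_mem (hv _ (lie_mem_left K L I x u hx)) (LieSubmodule.lie_mem _ (hv x hx))

namespace IsFork

variable {K L : Type*} [Field K] [CharZero K] [LieRing L] [LieAlgebra K L] {N : ℕ} {e : ℕ → L}
  {f : L}

theorem mem_lieSpan_forkVector (h : IsFork K N e f) (hN : 1 < N)
    (hgen : LieSubalgebra.lieSpan K L (insert f (e '' Set.Iio N)) = ⊤) :
    ∀ x ∈ LieSubmodule.lieSpan K L {f - e 0},
      x ∈ LieSubalgebra.lieSpan K L (forkVector e f '' Set.Iio N) := by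
  intro x hx
  induction hx using LieSubmodule.lieSpan_induction with
  | mem z hz =>
    obtain rfl : z = f - e 0 := hz
    exact LieSubalgebra.subset_lieSpan ⟨0, by simp; omega, rfl⟩
  | zero => exact zero_mem _
  | add u v _ _ hu hv => exact add_mem hu hv
  | smul t u _ hu => exact SMulMemClass.smul_mem t hu
  | lie u v _ hv =>
    refine lie_mem_lieSpan hgen _ ?_ u hv
    rintro g hg _ ⟨j, hj, rfl⟩
    exact h.lie_forkVector_mem hN hg hj

/-- In a Lie algebra generated by a fork, the ideal generated by the difference of the two end nodes
of the fork is solvable. -/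
theorem isSolvable_lieSpan (h : IsFork K N e f) (hN : 1 < N)
    (hgen : LieSubalgebra.lieSpan K L (insert f (e '' Set.Iio N)) = ⊤) :
    LieAlgebra.IsSolvable (LieSubmodule.lieSpan K L {f - e 0} : LieIdeal K L) := by
  set I : LieIdeal K L := LieSubmodule.lieSpan K L {f - e 0} with hIdef
  set P : LieIdeal K L :=
    LieSubmodule.lieSpan K L {⁅forkVector e f 0, forkVector e f 1⁆} with hP
  have hI := h.mem_lieSpan_forkVector hN hgen
  -- The second factor is the ideal generated by `w 0`, so only the brackets `[w j, w 0]` need to be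
  -- tested.
  have h1 : ⁅I, I⁆ ≤ P := by
    refine lie_lieSpan_singleton_le hI ?_
    rintro _ ⟨j, hj, rfl⟩
    rw [← lie_skew]
    exact neg_mem (h.lie_forkVector_mem_lieSpan j hj)
  have h2 : ⁅I, P⁆ ≤ ⊥ := by
    refine lie_lieSpan_singleton_le hI ?_
    rintro _ ⟨j, hj, rfl⟩
    rw [h.lie_lie_forkVector hN j hj]
    exact zero_mem _
  have h3 : LieAlgebra.derivedSeriesOfIdeal K L 2 I = ⊥ := by
    rw [LieAlgebra.derivedSeriesOfIdeal_succ, LieAlgebra.derivedSeriesOfIdeal_succ,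
      LieAlgebra.derivedSeriesOfIdeal_zero, eq_bot_iff]
    exact (LieSubmodule.mono_lie (LieSubmodule.lie_le_left I I) h1).trans h2
  exact LieAlgebra.IsSolvable.mk ((LieIdeal.derivedSeries_eq_bot_iff I 2).2 h3)

end IsFork

end Electrical

/-! ### The symplectic Lie algebra as symmetric products. -/

namespace Electrical

open Matrix LieAlgebra.Symplectic

theorem eq_sum_vecMulVec {m K : Type*} [Fintype m] [DecidableEq m] [CommRing K]
    (M : Matrix m m K) :
    M = ∑ a, ∑ b, M a b • vecMulVec (Pi.single a 1 : m → K) (Pi.single b 1) := by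
  ext i j
  simp [Matrix.sum_apply, vecMulVec_apply, Pi.single_apply]

section Symplectic

variable {l K : Type*} [Fintype l] [DecidableEq l] [Field K]

/-- The standard symplectic form. -/
def sympForm (u v : l ⊕ l → K) : K := u ⬝ᵥ (Matrix.J l K *ᵥ v)

theorem sympForm_eq_sum (u v : l ⊕ l → K) :
    sympForm u v = ∑ a, (u (Sum.inr a) * v (Sum.inl a) - u (Sum.inl a) * v (Sum.inr a)) := by
  simp only [sympForm, Matrix.J, dotProduct, fromBlocks_mulVec, Fintype.sum_sum_type, Sum.elim_inl,
    Sum.elim_inr, zero_mulVec, neg_mulVec, one_mulVec, Pi.neg_apply,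
    Function.comp_apply, zero_add, add_zero, mul_neg, Finset.sum_neg_distrib,
    Finset.sum_sub_distrib]
  ring

theorem sympForm_swap (u v : l ⊕ l → K) : sympForm u v = -sympForm v u := by
  rw [sympForm_eq_sum, sympForm_eq_sum, ← Finset.sum_neg_distrib]
  exact Finset.sum_congr rfl fun a _ => by ring

theorem sympForm_self (u : l ⊕ l → K) : sympForm u u = 0 := by
  rw [sympForm_eq_sum]
  exact Finset.sum_eq_zero fun a _ => by ring

theorem mem_sp_iff (A : Matrix (l ⊕ l) (l ⊕ l) K) :
    A ∈ sp l K ↔ Aᵀ * Matrix.J l K = -(Matrix.J l K * A) := by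
  rw [← mul_neg]
  exact mem_skewAdjointMatricesSubmodule (J := Matrix.J l K) (A₁ := A)

theorem vecMulVec_J_mul (u v x y : l ⊕ l → K) :
    (vecMulVec u v * Matrix.J l K) * (vecMulVec x y * Matrix.J l K) =
      sympForm v x • (vecMulVec u y * Matrix.J l K) := by
  rw [← Matrix.mul_assoc, Matrix.mul_assoc (vecMulVec u v), mul_vecMulVec, vecMulVec_mul_vecMulVec,
    vecMulVec_smul, smul_mul]
  rfl

/-- The element `z ↦ ω(u, z) v + ω(v, z) u` of the symplectic Lie algebra. -/
def spSymm : (l ⊕ l → K) →ₗ[K] (l ⊕ l → K) →ₗ[K] sp l K :=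
  LinearMap.mk₂ K
    (fun u v => ⟨(vecMulVec u v + vecMulVec v u) * Matrix.J l K, by
      rw [mem_sp_iff, transpose_mul, transpose_add, transpose_vecMulVec, transpose_vecMulVec,
        J_transpose, add_comm (vecMulVec v u)]
      simp [Matrix.mul_assoc]⟩)
    (fun u u' v => Subtype.ext <| by
      simp only [AddMemClass.coe_add, add_vecMulVec, vecMulVec_add, add_mul]; abel)
    (fun c u v => Subtype.ext <| by
      simp only [SetLike.val_smul, smul_vecMulVec, vecMulVec_smul, ← smul_add, smul_mul])
    (fun u v v' => Subtype.ext <| by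
      simp only [AddMemClass.coe_add, add_vecMulVec, vecMulVec_add, add_mul]; abel)
    (fun c u v => Subtype.ext <| by
      simp only [SetLike.val_smul, smul_vecMulVec, vecMulVec_smul, ← smul_add, smul_mul])

theorem coe_spSymm (u v : l ⊕ l → K) :
    (spSymm u v : Matrix (l ⊕ l) (l ⊕ l) K) =
      vecMulVec u v * Matrix.J l K + vecMulVec v u * Matrix.J l K :=
  add_mul _ _ _

theorem spSymm_swap (u v : l ⊕ l → K) : spSymm u v = spSymm v u :=
  Subtype.ext <| by rw [coe_spSymm, coe_spSymm, add_comm]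

theorem lie_spSymm_spSymm (u v x y : l ⊕ l → K) :
    ⁅spSymm u v, spSymm x y⁆ = sympForm v x • spSymm u y + sympForm v y • spSymm u x +
      sympForm u x • spSymm v y + sympForm u y • spSymm v x := by
  apply Subtype.ext
  simp only [LieSubalgebra.coe_bracket, AddMemClass.coe_add, SetLike.val_smul, coe_spSymm,
    LieRing.of_associative_ring_bracket, add_mul, mul_add, vecMulVec_J_mul]
  rw [sympForm_swap y u, sympForm_swap y v, sympForm_swap x u, sympForm_swap x v]
  module

theorem lie_spSymm (X : sp l K) (u v : l ⊕ l → K) :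
    ⁅X, spSymm u v⁆ = spSymm (X.1 *ᵥ u) v + spSymm u (X.1 *ᵥ v) := by
  have hX : Matrix.J l K * X.1 = -(X.1ᵀ * Matrix.J l K) := by
    rw [(mem_sp_iff X.1).1 X.2, neg_neg]
  have key (x y : l ⊕ l → K) : vecMulVec x y * Matrix.J l K * X.1 =
      -(vecMulVec x (X.1 *ᵥ y) * Matrix.J l K) := by
    rw [Matrix.mul_assoc, hX, mul_neg, ← Matrix.mul_assoc, vecMulVec_mul, vecMul_transpose]
  apply Subtype.ext
  simp only [LieSubalgebra.coe_bracket, AddMemClass.coe_add, coe_spSymm,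
    LieRing.of_associative_ring_bracket, add_mul, mul_add, key, ← Matrix.mul_assoc, mul_vecMulVec]
  abel

theorem spSymm_mulVec (u v x : l ⊕ l → K) :
    (spSymm u v).1 *ᵥ x = sympForm v x • u + sympForm u x • v := by
  rw [coe_spSymm, add_mulVec, ← mulVec_mulVec, ← mulVec_mulVec, vecMulVec_mulVec, vecMulVec_mulVec]
  simp [sympForm]

theorem sympForm_mulVec_comm (X : sp l K) (u v : l ⊕ l → K) :
    sympForm u (X.1 *ᵥ v) = sympForm v (X.1 *ᵥ u) := by
  have hX : Matrix.J l K * X.1 = -(X.1ᵀ * Matrix.J l K) := by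
    rw [(mem_sp_iff X.1).1 X.2, neg_neg]
  have h : sympForm u (X.1 *ᵥ v) = -sympForm (X.1 *ᵥ u) v := by
    rw [sympForm, sympForm, mulVec_mulVec, hX, neg_mulVec, dotProduct_neg, ← mulVec_mulVec,
      dotProduct_mulVec, vecMul_transpose]
  rw [h, sympForm_swap v]

theorem eq_zero_of_sympForm_eq_zero {v : l ⊕ l → K} (h : ∀ u, sympForm u v = 0) : v = 0 := by
  have h1 : Matrix.J l K *ᵥ v = 0 := dotProduct_eq_zero _ fun u => by
    rw [dotProduct_comm]
    exact h u
  have h2 := congrArg (fun x => Matrix.J l K *ᵥ x) h1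
  simpa [mulVec_mulVec, J_squared, neg_mulVec] using h2

variable [CharZero K]

/-- For `X` in the symplectic algebra, `Y = -XJ` is symmetric and `X = YJ`; averaging the expansions
of `Y` and its transpose in matrix units gives symmetric products. -/
theorem span_spSymm : Submodule.span K {X : sp l K | ∃ u v, X = spSymm u v} = ⊤ := by
  rw [eq_top_iff]
  rintro X -
  have hX := (mem_sp_iff X.1).1 X.2
  set Y := -(X.1 * Matrix.J l K) with hY
  have hYt : Yᵀ = Y := by
    have h1 := congrArg (fun M => Matrix.J l K * M * Matrix.J l K) hX
    have h2 : Matrix.J l K * X.1ᵀ = -(X.1 * Matrix.J l K) := by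
      simpa only [Matrix.mul_assoc, J_squared, mul_neg, neg_mul, Matrix.mul_one, neg_inj,
        ← Matrix.mul_assoc (Matrix.J l K) (Matrix.J l K), Matrix.one_mul, neg_neg,
        neg_eq_iff_eq_neg] using h1
    rw [hY, transpose_neg, transpose_mul, J_transpose, neg_mul, neg_neg, h2]
  have hYJ : Y * Matrix.J l K = X.1 := by
    rw [hY, neg_mul, Matrix.mul_assoc, J_squared, mul_neg, neg_neg, Matrix.mul_one]
  have key : X = ∑ a, ∑ b, (2⁻¹ * Y a b) •
      spSymm (Pi.single a 1 : l ⊕ l → K) (Pi.single b 1 : l ⊕ l → K) := by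
    apply Subtype.ext
    have h1 : Y * Matrix.J l K = ∑ a, ∑ b,
        Y a b • (vecMulVec (Pi.single a 1 : l ⊕ l → K) (Pi.single b 1) * Matrix.J l K) := by
      conv_lhs => rw [eq_sum_vecMulVec Y]
      simp only [Finset.sum_mul, smul_mul]
    have h2 : Y * Matrix.J l K = ∑ a, ∑ b,
        Y a b • (vecMulVec (Pi.single b 1 : l ⊕ l → K) (Pi.single a 1) * Matrix.J l K) := by
      conv_lhs => rw [← hYt, eq_sum_vecMulVec Y]
      simp only [transpose_sum, transpose_smul, transpose_vecMulVec, Finset.sum_mul, smul_mul]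
    have h3 : X.1 = (2⁻¹ : K) • (Y * Matrix.J l K + Y * Matrix.J l K) := by
      rw [hYJ, ← two_smul K, smul_smul, inv_mul_cancel₀ two_ne_zero, one_smul]
    rw [h3]
    nth_rewrite 1 [h1]
    rw [h2]
    simp only [AddSubmonoidClass.coe_finsetSum, SetLike.val_smul, coe_spSymm,
      ← Finset.sum_add_distrib, Finset.smul_sum, ← smul_add, smul_smul]
  rw [key]
  exact Submodule.sum_mem _ fun a _ => Submodule.sum_mem _ fun b _ =>
    Submodule.smul_mem _ _ (Submodule.subset_span ⟨_, _, rfl⟩)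

instance hasTrivialRadical_sp : LieAlgebra.HasTrivialRadical K (sp l K) := by
  rw [LieAlgebra.hasTrivialRadical_iff_no_abelian_ideals]
  intro A hA
  have habel : ∀ x ∈ A, ∀ y ∈ A, ⁅x, y⁆ = 0 := fun x hx y hy =>
    congrArg Subtype.val (hA.trivial ⟨x, hx⟩ ⟨y, hy⟩)
  rw [LieSubmodule.eq_bot_iff]
  intro X hX
  -- Otherwise two brackets with `spSymm u u` put it in the abelian ideal `A`. Commutation with
  -- `[spSymm z z, spSymm u u]`, also in `A`, then forces `spSymm u u = 0`, hence `u = 0`.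
  have hzero : ∀ u, sympForm u (X.1 *ᵥ u) = 0 := by
    intro u
    by_contra hne
    set z := X.1 *ᵥ u with hz
    have h1 : spSymm u u ∈ A := by
      have h2 : ⁅spSymm u u, ⁅X, spSymm u u⁆⁆ = (4 * sympForm u z) • spSymm u u := by
        rw [lie_spSymm, ← hz, spSymm_swap u z, lie_add, lie_spSymm_spSymm, sympForm_self]
        module
      have h3 : ⁅spSymm u u, ⁅X, spSymm u u⁆⁆ ∈ A := by
        rw [← lie_skew X, lie_neg]
        exact neg_mem (LieSubmodule.lie_mem _ (LieSubmodule.lie_mem _ hX))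
      rw [h2] at h3
      have four_ne_zero : (4 : K) ≠ 0 := by norm_num
      have h4 := A.smul_mem (4 * sympForm u z)⁻¹ h3
      rwa [smul_smul, inv_mul_cancel₀ (mul_ne_zero four_ne_zero hne), one_smul] at h4
    have h2 : ⁅spSymm u u, ⁅spSymm z z, spSymm u u⁆⁆ =
        (-8 * sympForm u z ^ 2) • spSymm u u := by
      rw [lie_spSymm_spSymm z z u u, sympForm_swap z u]
      simp only [lie_add, lie_smul, lie_spSymm_spSymm, sympForm_self]
      module
    rw [habel _ h1 _ (LieSubmodule.lie_mem _ h1), eq_comm, smul_eq_zero] at h2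
    have h3 : spSymm u u = 0 := h2.resolve_left (by simp [hne])
    have h4 := spSymm_mulVec u u z
    rw [h3, ZeroMemClass.coe_zero, zero_mulVec, ← add_smul, eq_comm, smul_eq_zero, ← two_mul] at h4
    have h5 : u = 0 := h4.resolve_left (mul_ne_zero two_ne_zero hne)
    exact hne (by simp [h5, sympForm])
  -- Polarization: `ω(u, Xv)` is symmetric in `u` and `v`.
  have hzero' : ∀ u v, sympForm u (X.1 *ᵥ v) = 0 := by
    intro u v
    have h1 := hzero (u + v)
    have h2 := sympForm_mulVec_comm X u v
    have hu := hzero u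
    have hv := hzero v
    simp only [sympForm, mulVec_add, dotProduct_add, add_dotProduct] at h1 h2 hu hv ⊢
    rw [hu, hv, ← h2] at h1
    simpa using h1
  apply Subtype.ext
  ext i j
  have h1 := congrFun (eq_zero_of_sympForm_eq_zero fun u => hzero' u (Pi.single j 1)) i
  simpa using h1

end Symplectic

end Electrical

/-! ### A basis with tridiagonal Gram matrix. -/

namespace Electrical

open Matrix LieAlgebra.Symplectic

section ChainVector

variable (K : Type*) [Field K] (n : ℕ)

/-- A basis of the standard symplectic space with respect to which the Gram matrix of the symplectic
form is tridiagonal: with the standard basis `p_a, q_a`, the vectors are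
`p_0, q_0, p_1 - p_0, q_1, p_2 - p_1, …`. -/
def chainVector (i : ℕ) : Fin n ⊕ Fin n → K :=
  Sum.elim (fun a => if i = 2 * a.1 then 1 else if i = 2 * a.1 + 2 then -1 else 0)
    (fun a => if i = 2 * a.1 + 1 then 1 else 0)

theorem sympForm_chainVector_even_even (a b : ℕ) :
    sympForm (chainVector K n (2 * a)) (chainVector K n (2 * b)) = 0 := by
  rw [sympForm_eq_sum]
  refine Finset.sum_eq_zero fun c _ => ?_
  have h1 : 2 * a ≠ 2 * c.1 + 1 := by omega
  have h2 : 2 * b ≠ 2 * c.1 + 1 := by omega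
  simp [chainVector, h1, h2]

theorem sympForm_chainVector_odd_odd (a b : ℕ) :
    sympForm (chainVector K n (2 * a + 1)) (chainVector K n (2 * b + 1)) = 0 := by
  rw [sympForm_eq_sum]
  refine Finset.sum_eq_zero fun c _ => ?_
  have h (d : ℕ) : 2 * d + 1 ≠ 2 * c.1 ∧ 2 * d + 1 ≠ 2 * c.1 + 2 := by omega
  simp only [chainVector, Sum.elim_inl, Sum.elim_inr, h, if_false]
  simp

theorem sympForm_chainVector_even_odd (a b : ℕ) (hb : b < n) :
    sympForm (chainVector K n (2 * a)) (chainVector K n (2 * b + 1)) =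
      -(if a = b then 1 else if a = b + 1 then -1 else 0) := by
  rw [sympForm_eq_sum, Finset.sum_eq_single ⟨b, hb⟩]
  · have h1 : 2 * a = 2 * b + 2 ↔ a = b + 1 := by omega
    have h2 : 2 * a ≠ 2 * b + 1 := by omega
    simp [chainVector, h1, h2]
  · intro c _ hc
    have h1 : b ≠ c.1 := fun h => hc (Fin.ext h.symm)
    have h2 : 2 * a ≠ 2 * c.1 + 1 := by omega
    simp [chainVector, h1, h2]
  · simp

theorem sympForm_chainVector_succ (i : ℕ) (hi : i + 1 < 2 * n) :
    sympForm (chainVector K n i) (chainVector K n (i + 1)) = -1 := by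
  obtain ⟨a, rfl | rfl⟩ := Nat.even_or_odd' i
  · rw [sympForm_chainVector_even_odd K n a a (by omega), if_pos rfl]
  · rw [sympForm_swap, show 2 * a + 1 + 1 = 2 * (a + 1) by ring,
      sympForm_chainVector_even_odd K n (a + 1) a (by omega)]
    simp

theorem sympForm_chainVector_pred (i : ℕ) (hi : i + 1 < 2 * n) :
    sympForm (chainVector K n (i + 1)) (chainVector K n i) = 1 := by
  rw [sympForm_swap, sympForm_chainVector_succ K n i hi, neg_neg]

theorem sympForm_chainVector_far (i j : ℕ) (hij : i + 1 < j) (hj : j < 2 * n) :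
    sympForm (chainVector K n i) (chainVector K n j) = 0 := by
  obtain ⟨a, rfl | rfl⟩ := Nat.even_or_odd' i <;> obtain ⟨b, rfl | rfl⟩ := Nat.even_or_odd' j
  · exact sympForm_chainVector_even_even K n a b
  · rw [sympForm_chainVector_even_odd K n a b (by omega), if_neg (by omega), if_neg (by omega),
      neg_zero]
  · rw [sympForm_swap, sympForm_chainVector_even_odd K n b a (by omega), if_neg (by omega),
      if_neg (by omega), neg_zero, neg_zero]
  · exact sympForm_chainVector_odd_odd K n a b

theorem span_chainVector :
    Submodule.span K (Set.range fun i : Fin (2 * n) => chainVector K n i) = ⊤ := by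
  set S := Submodule.span K (Set.range fun i : Fin (2 * n) => chainVector K n i)
  have hS : ∀ i, i < 2 * n → chainVector K n i ∈ S :=
    fun i hi => Submodule.subset_span ⟨⟨i, hi⟩, rfl⟩
  have hr : ∀ a : Fin n, (Pi.single (Sum.inr a) 1 : Fin n ⊕ Fin n → K) ∈ S := by
    intro a
    convert hS (2 * a.1 + 1) (by omega) using 1
    ext (b | b)
    · have h1 : 2 * a.1 + 1 ≠ 2 * b.1 := by omega
      have h2 : 2 * a.1 ≠ 2 * b.1 + 1 := by omega
      simp [chainVector, h1, h2]
    · simp [chainVector, Pi.single_apply, Fin.ext_iff, eq_comm]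
  have hl : ∀ a (ha : a < n), (Pi.single (Sum.inl ⟨a, ha⟩) 1 : Fin n ⊕ Fin n → K) ∈ S := by
    intro a
    induction a with
    | zero =>
      intro ha
      convert hS 0 (by omega) using 1
      ext (b | b)
      · simp [chainVector, Pi.single_apply, Fin.ext_iff, eq_comm]
      · simp [chainVector]
    | succ a ih =>
      intro ha
      convert S.add_mem (hS (2 * (a + 1)) (by omega)) (ih (by omega)) using 1
      ext (b | b)
      · have h1 : 2 * (a + 1) = 2 * b.1 ↔ b.1 = a + 1 := by omega
        have h2 : 2 * (a + 1) = 2 * b.1 + 2 ↔ b.1 = a := by omega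
        simp only [chainVector, Pi.single_apply, Sum.inl.injEq, Fin.ext_iff, h1, h2, Pi.add_apply,
          Sum.elim_inl]
        split_ifs <;> first | omega | simp
      · have h1 : 2 * (a + 1) ≠ 2 * b.1 + 1 := by omega
        simp [chainVector, h1]
  rw [eq_top_iff, ← (Pi.basisFun K (Fin n ⊕ Fin n)).span_eq, Submodule.span_le]
  rintro _ ⟨a | a, rfl⟩
  · rw [Pi.basisFun_apply]
    exact hl a.1 a.2
  · rw [Pi.basisFun_apply]
    exact hr a

theorem linearIndependent_chainVector :
    LinearIndependent K fun i : Fin (2 * n) => chainVector K n i :=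
  linearIndependent_of_top_le_span_of_card_eq_finrank (span_chainVector K n).ge
    (by simp [two_mul])

theorem exists_dual_chainVector : ∃ d : Fin (2 * n) → Fin n ⊕ Fin n → K,
    ∀ i j : Fin (2 * n), d i ⬝ᵥ chainVector K n j = if i = j then 1 else 0 := by
  set b := Module.Basis.mk (linearIndependent_chainVector K n) (span_chainVector K n).ge
  refine ⟨fun i a => b.coord i (Pi.single a 1), fun i j => ?_⟩
  have h1 : b.coord i (chainVector K n j) = if i = j then 1 else 0 := by
    have : b j = chainVector K n j := Module.Basis.mk_apply _ _ _
    rw [← this]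
    simp [Finsupp.single_apply, eq_comm]
  rw [← h1]
  conv_rhs => rw [pi_eq_sum_univ' (chainVector K n j)]
  rw [map_sum]
  refine Finset.sum_congr rfl fun a _ => ?_
  rw [map_smul, smul_eq_mul, mul_comm]

variable [CharZero K]

/-- The symmetric products of the vectors of the chain are linearly independent. -/
theorem linearIndependent_spSymm_chainVector :
    LinearIndependent K fun p : {p : Fin (2 * n) × Fin (2 * n) // p.1 ≤ p.2} =>
      spSymm (chainVector K n p.1.1) (chainVector K n p.1.2) := by
  obtain ⟨d, hd⟩ := exists_dual_chainVector K n
  rw [Fintype.linearIndependent_iff]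
  intro c hc q
  -- The matrix `XJ` is minus a symmetrized tensor, so pairing it with two dual vectors isolates the
  -- coefficient of one unordered pair, up to the factor `-1`, or `-2` on the diagonal.
  have h1 := congrArg
    (fun X : sp (Fin n) K => d q.1.1 ⬝ᵥ ((X.1 * Matrix.J (Fin n) K) *ᵥ d q.1.2)) hc
  have h2 (u v : Fin n ⊕ Fin n → K) :
      d q.1.1 ⬝ᵥ (((spSymm u v).1 * Matrix.J (Fin n) K) *ᵥ d q.1.2) =
        -((d q.1.1 ⬝ᵥ u) * (d q.1.2 ⬝ᵥ v) + (d q.1.1 ⬝ᵥ v) * (d q.1.2 ⬝ᵥ u)) := by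
    rw [coe_spSymm, add_mul, Matrix.mul_assoc, Matrix.mul_assoc, J_squared]
    simp only [mul_neg, Matrix.mul_one, neg_mulVec, add_mulVec, vecMulVec_mulVec, dotProduct_neg,
      dotProduct_add, dotProduct_comm _ (d q.1.2)]
    simp
    ring
  simp only [AddSubmonoidClass.coe_finsetSum, SetLike.val_smul, Finset.sum_mul, sum_mulVec,
    dotProduct_sum, smul_mul, smul_mulVec, dotProduct_smul, h2, hd] at h1
  rw [Finset.sum_eq_single q] at h1
  · obtain ⟨⟨a, b⟩, hab⟩ := q
    by_cases h : a = b
    · subst h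
      simpa [← two_mul] using h1
    · simpa [h, Ne.symm h] using h1
  · rintro ⟨⟨i, j⟩, hij⟩ - hne
    obtain ⟨⟨a, b⟩, hab⟩ := q
    have h3 : ¬(a = i ∧ b = j) := fun h => hne (by simp [h.1, h.2])
    have h4 : ¬(a = j ∧ b = i) := by
      rintro ⟨rfl, rfl⟩
      have := le_antisymm hab hij
      exact h3 ⟨this, this.symm⟩
    simp only [ite_zero_mul_ite_zero, if_neg h3, if_neg h4, add_zero, neg_zero, smul_zero]
  · simp

end ChainVector

end Electrical

/-! ### Chain generators and the comparison with the symplectic algebra. -/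

namespace Electrical

open Matrix LieAlgebra.Symplectic

section SpGen

variable (K : Type*) [Field K] (n : ℕ)

/-- Generators of the symplectic Lie algebra that satisfy the electrical relations of type `A`. -/
def spGen (i : ℕ) : sp (Fin n) K :=
  ((-1) ^ i / 2 : K) • spSymm (chainVector K n i) (chainVector K n i)

variable [CharZero K]

theorem lie_spGen_spSymm (i : ℕ) (x y : Fin n ⊕ Fin n → K) :
    ⁅spGen K n i, spSymm x y⁆ = ((-1) ^ i : K) •
      (sympForm (chainVector K n i) x • spSymm (chainVector K n i) y +
        sympForm (chainVector K n i) y • spSymm (chainVector K n i) x) := by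
  rw [spGen, smul_lie, lie_spSymm_spSymm]
  module

theorem lie_spGen_succ (i : ℕ) (hi : i + 1 < 2 * n) :
    ⁅spGen K n i, spGen K n (i + 1)⁆ =
      spSymm (chainVector K n i) (chainVector K n (i + 1)) := by
  have h : ((-1) ^ i : K) * (-1) ^ i = 1 := by rw [← mul_pow]; simp
  have h2 : ((-1) ^ (i + 1) / 2 * (-1) ^ i * (-2) : K) = 1 := by
    rw [pow_succ]
    linear_combination h
  rw [spGen.eq_1 K n (i + 1), lie_smul, lie_spGen_spSymm, sympForm_chainVector_succ K n i hi]
  refine Eq.trans (b := ((-1) ^ (i + 1) / 2 * (-1) ^ i * (-2) : K) •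
    spSymm (chainVector K n i) (chainVector K n (i + 1))) ?_ ?_
  · module
  · rw [h2, one_smul]

/-- For multiples `c_i / 2` of the squares, the double bracket of neighbours is `2 c_i c_{i+1}
ω(v_i, v_{i+1})²` times a generator; the value `-2` forces the alternating signs. -/
theorem isChain_spGen : IsChain K (2 * n) (spGen K n) where
  lie_lie_succ i hi := by
    rw [lie_spGen_succ K n i hi, lie_spGen_spSymm, sympForm_self,
      sympForm_chainVector_succ K n i hi, spGen]
    module
  lie_lie_pred i hi := by
    rw [← lie_skew (spGen K n (i + 1)) (spGen K n i), lie_neg, lie_spGen_succ K n i hi,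
      lie_spGen_spSymm, sympForm_self, sympForm_chainVector_pred K n i hi, spGen]
    module
  lie_eq_zero i j hij hj := by
    rw [spGen.eq_1 K n j, lie_smul, lie_spGen_spSymm, sympForm_chainVector_far K n i j hij hj]
    simp

/-- In a product `v_{i+1} v_{i+d}` with `d ≥ 2`, only the first factor pairs with `v_i`, so the
generator replaces `v_{i+1}` by `v_i`, up to sign. -/
theorem chainBracket_spGen : ∀ d i, i + d < 2 * n → ∃ c : K, c ≠ 0 ∧
    chainBracket (spGen K n) i d = c • spSymm (chainVector K n i) (chainVector K n (i + d))
  | 0, i, _ => ⟨(-1) ^ i / 2, by simp, rfl⟩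
  | 1, i, hi => ⟨1, one_ne_zero, by
      rw [one_smul]
      exact lie_spGen_succ K n i hi⟩
  | d + 2, i, hi => by
    obtain ⟨c, hc, h⟩ := chainBracket_spGen (d + 1) (i + 1) (by omega)
    refine ⟨c * (-1) ^ i * -1, by simp [hc], ?_⟩
    rw [chainBracket, h, lie_smul, lie_spGen_spSymm, sympForm_chainVector_succ K n i (by omega),
      sympForm_chainVector_far K n i _ (by omega) (by omega),
      show i + 1 + (d + 1) = i + (d + 2) by ring]
    module

theorem lieSpan_spGen :
    LieSubalgebra.lieSpan K (sp (Fin n) K) (spGen K n '' Set.Iio (2 * n)) = ⊤ := by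
  set T := LieSubalgebra.lieSpan K (sp (Fin n) K) (spGen K n '' Set.Iio (2 * n))
  have h1 : ∀ d i, i + d < 2 * n → chainBracket (spGen K n) i d ∈ T := by
    intro d
    induction d with
    | zero => exact fun i hi => LieSubalgebra.subset_lieSpan ⟨i, hi, rfl⟩
    | succ d ih =>
      exact fun i hi => T.lie_mem (LieSubalgebra.subset_lieSpan ⟨i, by simp; omega, rfl⟩)
        (ih (i + 1) (by omega))
  have h2 : ∀ i d, i + d < 2 * n →
      spSymm (chainVector K n i) (chainVector K n (i + d)) ∈ T := by
    intro i d hd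
    obtain ⟨c, hc, h⟩ := chainBracket_spGen K n d i hd
    have h3 := T.smul_mem c⁻¹ (h1 d i hd)
    rwa [h, smul_smul, inv_mul_cancel₀ hc, one_smul] at h3
  have h3 : ∀ i j, i < 2 * n → j < 2 * n → spSymm (chainVector K n i) (chainVector K n j) ∈ T := by
    intro i j hi hj
    rcases le_total i j with h | h
    · obtain ⟨d, rfl⟩ := Nat.exists_eq_add_of_le h
      exact h2 i d hj
    · obtain ⟨d, rfl⟩ := Nat.exists_eq_add_of_le h
      rw [spSymm_swap]
      exact h2 j d hi
  have h4 : ∀ u v : Fin n ⊕ Fin n → K, spSymm u v ∈ T := by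
    intro u v
    have hu : u ∈ Submodule.span K (Set.range fun i : Fin (2 * n) => chainVector K n i) := by
      rw [span_chainVector]
      exact Submodule.mem_top
    have hv : v ∈ Submodule.span K (Set.range fun i : Fin (2 * n) => chainVector K n i) := by
      rw [span_chainVector]
      exact Submodule.mem_top
    induction hu, hv using Submodule.span_induction₂ with
    | mem_mem x y hx hy =>
      obtain ⟨i, rfl⟩ := hx
      obtain ⟨j, rfl⟩ := hy
      exact h3 i j i.2 j.2
    | zero_left => simp
    | zero_right => simp
    | add_left x y z _ _ _ hx hy => rw [map_add, LinearMap.add_apply]; exact T.add_mem hx hy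
    | add_right x y z _ _ _ hx hy => rw [map_add]; exact T.add_mem hx hy
    | smul_left r x y _ _ h => rw [map_smul, LinearMap.smul_apply]; exact T.smul_mem r h
    | smul_right r x y _ _ h => rw [map_smul]; exact T.smul_mem r h
  rw [eq_top_iff]
  intro X _
  have hX : X ∈ Submodule.span K {X : sp (Fin n) K | ∃ u v, X = spSymm u v} := by
    rw [span_spSymm]
    exact Submodule.mem_top
  refine (Submodule.span_le (p := T.toSubmodule)).2 ?_ hX
  rintro _ ⟨u, v, rfl⟩
  exact h4 u v

end SpGen

theorem map_chainBracket {K L L' : Type*} [CommRing K] [LieRing L] [LieAlgebra K L] [LieRing L']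
    [LieAlgebra K L'] (φ : L →ₗ⁅K⁆ L') (e : ℕ → L) :
    ∀ d i, φ (chainBracket e i d) = chainBracket (fun k => φ (e k)) i d
  | 0, i => rfl
  | d + 1, i => by rw [chainBracket, LieHom.map_lie, map_chainBracket φ e d (i + 1), chainBracket]

theorem chainBracket_congr {L : Type*} [LieRing L] {e e' : ℕ → L} {N : ℕ}
    (h : ∀ i < N, e i = e' i) : ∀ d i, i + d < N → chainBracket e i d = chainBracket e' i d
  | 0, i, hi => h i hi
  | d + 1, i, hi => by
    rw [chainBracket, chainBracket, h i (by omega), chainBracket_congr h d (i + 1) (by omega)]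

theorem injective_of_linearIndependent_comp {K ι V W : Type*} [Field K] [Fintype ι]
    [AddCommGroup V] [Module K V] [AddCommGroup W] [Module K W] {b : ι → V}
    (hb : Submodule.span K (Set.range b) = ⊤) (φ : V →ₗ[K] W)
    (h : LinearIndependent K (φ ∘ b)) : Function.Injective φ := by
  rw [injective_iff_map_eq_zero]
  intro x hx
  have hx' : x ∈ Submodule.span K (Set.range b) := hb ▸ Submodule.mem_top
  obtain ⟨c, rfl⟩ := (Submodule.mem_span_range_iff_exists_fun K).1 hx'
  rw [map_sum] at hx
  simp only [map_smul] at hx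
  have hc := Fintype.linearIndependent_iff.1 h c hx
  simp [hc]

/-- A Lie algebra that is generated by a chain of length `2 * n` and maps to the symplectic Lie
algebra compatibly with the generators is isomorphic to it. -/
theorem bijective_of_isChain {K L : Type*} [Field K] [CharZero K] [LieRing L] [LieAlgebra K L]
    {n : ℕ} {e : ℕ → L} (h : IsChain K (2 * n) e)
    (hgen : LieSubalgebra.lieSpan K L (e '' Set.Iio (2 * n)) = ⊤)
    (φ : L →ₗ⁅K⁆ sp (Fin n) K) (hφ : ∀ i < 2 * n, φ (e i) = spGen K n i) :
    Function.Bijective φ := by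
  constructor
  · let b : {p : Fin (2 * n) × Fin (2 * n) // p.1 ≤ p.2} → L :=
      fun p => chainBracket e p.1.1 (p.1.2 - p.1.1)
    have hb : Submodule.span K (Set.range b) = ⊤ := by
      rw [← h.span_chainBracket_eq_top hgen]
      congr 1
      ext x
      constructor
      · rintro ⟨⟨⟨i, j⟩, hij⟩, rfl⟩
        have hij' : i.1 ≤ j.1 := hij
        exact ⟨i, j - i, by have := j.2; omega, rfl⟩
      · rintro ⟨i, d, hd, rfl⟩
        exact ⟨⟨(⟨i, by omega⟩, ⟨i + d, hd⟩), by simp⟩, by simp [b]⟩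
    have hc : ∀ p : {p : Fin (2 * n) × Fin (2 * n) // p.1 ≤ p.2}, ∃ c : Kˣ,
        φ (b p) = c • spSymm (chainVector K n p.1.1) (chainVector K n p.1.2) := by
      rintro ⟨⟨i, j⟩, hij⟩
      have hij' : i.1 ≤ j.1 := hij
      have hj := j.2
      obtain ⟨c, hc, h1⟩ := chainBracket_spGen K n (j - i) i (by omega)
      refine ⟨Units.mk0 c hc, ?_⟩
      rw [map_chainBracket, chainBracket_congr hφ _ _ (by simp only; omega)]
      simp only [h1, Units.smul_mk0, Nat.add_sub_cancel' hij']
    -- A spanning family is sent to unit multiples of an independent one, which gives injectivity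
    -- without computing a dimension.
    choose c hc using hc
    refine injective_of_linearIndependent_comp hb (φ : L →ₗ[K] sp (Fin n) K) ?_
    have hφb : (φ : L →ₗ[K] sp (Fin n) K) ∘ b =
        c • fun p => spSymm (chainVector K n p.1.1) (chainVector K n p.1.2) := funext hc
    rw [hφb]
    exact (linearIndependent_spSymm_chainVector K n).units_smul c
  · have h1 : (⊤ : LieSubalgebra K (sp (Fin n) K)) ≤ φ.range := by
      rw [← lieSpan_spGen K n, LieSubalgebra.lieSpan_le]
      rintro _ ⟨i, hi, rfl⟩
      exact ⟨e i, hφ i hi⟩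
    intro X
    exact (LieHom.mem_range φ X).1 (h1 (LieSubalgebra.mem_top X))

end Electrical

/-! ### Quotients, radicals and presentations. -/

namespace Electrical

open LieAlgebra.Symplectic

/-- A morphism of Lie algebras that vanishes on an ideal factors through the quotient. -/
def quotientLift {R L L' : Type*} [CommRing R] [LieRing L] [LieAlgebra R L] [LieRing L']
    [LieAlgebra R L'] (I : LieIdeal R L) (φ : L →ₗ⁅R⁆ L') (h : I ≤ φ.ker) : (L ⧸ I) →ₗ⁅R⁆ L' :=
  { I.toSubmodule.liftQ (φ : L →ₗ[R] L') (fun x hx => LieHom.mem_ker.1 (h hx)) with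
    map_lie' := by
      intro x y
      induction x using Submodule.Quotient.induction_on
      induction y using Submodule.Quotient.induction_on
      exact φ.map_lie _ _ }

/-- If the quotient by a solvable ideal `I` has trivial radical, then `I` is the radical. -/
theorem eq_radical_of_ker {R L L' : Type*} [CommRing R] [LieRing L] [LieAlgebra R L] [LieRing L']
    [LieAlgebra R L'] [LieAlgebra.HasTrivialRadical R L'] {I : LieIdeal R L}
    (hI : LieAlgebra.IsSolvable I) {φ : L →ₗ⁅R⁆ L'} (hφ : Function.Surjective φ)
    (hker : φ.ker ≤ I) : I = LieAlgebra.radical R L := by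
  refine le_antisymm (le_sSup hI) (sSup_le fun A hA => ?_)
  have hA : LieAlgebra.IsSolvable A := hA
  let ψ : A →ₗ⁅R⁆ (A.map φ : LieIdeal R L') :=
    { toFun := fun x => ⟨φ x, LieIdeal.mem_map x.2⟩
      map_add' := fun x y => Subtype.ext (map_add φ _ _)
      map_smul' := fun t x => Subtype.ext (map_smul φ _ _)
      map_lie' := fun {x y} => Subtype.ext (φ.map_lie _ _) }
  have hψ : Function.Surjective ψ := by
    rintro ⟨y, hy⟩
    obtain ⟨x, hx⟩ := LieIdeal.mem_map_of_surjective hφ hy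
    exact ⟨x, Subtype.ext hx⟩
  have : LieAlgebra.IsSolvable (A.map φ : LieIdeal R L') := hψ.lieAlgebra_isSolvable
  have h0 := LieAlgebra.HasTrivialRadical.eq_bot_of_isSolvable (A.map φ)
  exact ((LieIdeal.map_eq_bot_iff).1 h0).trans hker

section Presentation

variable (R : Type*) [CommRing R] {ι : Type*}

/-- The universal property gives a map into the generated subalgebra; followed by the inclusion it
fixes the generators, hence is the identity. -/
theorem lieSpan_range_of :
    LieSubalgebra.lieSpan R (FreeLieAlgebra R ι) (Set.range (FreeLieAlgebra.of R)) = ⊤ := by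
  set T := LieSubalgebra.lieSpan R (FreeLieAlgebra R ι) (Set.range (FreeLieAlgebra.of R))
  let g : FreeLieAlgebra R ι →ₗ⁅R⁆ T :=
    FreeLieAlgebra.lift R fun i => ⟨FreeLieAlgebra.of R i, LieSubalgebra.subset_lieSpan ⟨i, rfl⟩⟩
  have hg : T.incl.comp g = LieHom.id := FreeLieAlgebra.hom_ext fun i => by
    simp [g]
  rw [eq_top_iff]
  intro x _
  have hx : (g x : FreeLieAlgebra R ι) = x := LieHom.congr_fun hg x
  exact hx ▸ (g x).2

/-- The image of a generating set in a quotient Lie algebra is generating. -/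
theorem lieSpan_image_mk {L : Type*} [LieRing L] [LieAlgebra R L] (I : LieIdeal R L) {s : Set L}
    (hs : LieSubalgebra.lieSpan R L s = ⊤) :
    LieSubalgebra.lieSpan R (L ⧸ I) ((fun x => LieSubmodule.Quotient.mk x) '' s) = ⊤ := by
  rw [eq_top_iff]
  intro y _
  obtain ⟨x, rfl⟩ := Submodule.Quotient.mk_surjective _ y
  have hx : x ∈ LieSubalgebra.lieSpan R L s := hs ▸ LieSubalgebra.mem_top x
  induction hx using LieSubalgebra.lieSpan_induction with
  | mem x hx => exact LieSubalgebra.subset_lieSpan ⟨x, hx, rfl⟩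
  | zero => exact zero_mem _
  | add u v _ _ hu hv => exact add_mem (hu trivial) (hv trivial)
  | smul t u _ hu => exact SMulMemClass.smul_mem t (hu trivial)
  | lie u v _ _ hu hv => exact LieSubalgebra.lie_mem _ (hu trivial) (hv trivial)

variable (A : Matrix ι ι ℤ)

theorem lieSpan_range_gen :
    LieSubalgebra.lieSpan R (ElectricalLieAlgebra R A) (Set.range (gen R A)) = ⊤ := by
  rw [← lieSpan_image_mk R (relatorIdeal R A) (lieSpan_range_of R), ← Set.range_comp]
  rfl

variable {A}

theorem mk_relator_eq_zero {i j : ι} (hij : i ≠ j) :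
    (LieSubmodule.Quotient.mk (relator R A i j) : ElectricalLieAlgebra R A) = 0 :=
  LieSubmodule.Quotient.mk_eq_zero'.2 (LieSubmodule.subset_lieSpan ⟨i, j, hij, rfl⟩)

theorem lie_lie_gen {i j : ι} (hij : i ≠ j) (h : A i j = -1) :
    ⁅gen R A i, ⁅gen R A i, gen R A j⁆⁆ = (-2 : R) • gen R A i := by
  have h1 := mk_relator_eq_zero R (A := A) hij
  rw [relator, h, if_pos rfl, show (1 - (-1) : ℤ).toNat = 2 from rfl, pow_two] at h1
  exact sub_eq_zero.1 h1

theorem lie_gen {i j : ι} (hij : i ≠ j) (h : A i j = 0) : ⁅gen R A i, gen R A j⁆ = 0 := by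
  have h1 := mk_relator_eq_zero R (A := A) hij
  rw [relator, h, if_neg (by decide), show (1 - 0 : ℤ).toNat = 1 from rfl, pow_one, sub_zero] at h1
  exact h1

/-- The morphism out of an electrical Lie algebra given by elements that satisfy the relations. -/
theorem exists_lieHom {L : Type*} [LieRing L] [LieAlgebra R L] (x : ι → L)
    (h1 : ∀ i j, i ≠ j → A i j = -1 → ⁅x i, ⁅x i, x j⁆⁆ = (-2 : R) • x i)
    (h0 : ∀ i j, i ≠ j → A i j = 0 → ⁅x i, x j⁆ = 0)
    (hA : ∀ i j, i ≠ j → A i j = -1 ∨ A i j = 0) :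
    ∃ φ : ElectricalLieAlgebra R A →ₗ⁅R⁆ L, ∀ i, φ (gen R A i) = x i := by
  refine ⟨quotientLift _ (FreeLieAlgebra.lift R x) ?_, fun i => FreeLieAlgebra.lift_of_apply x i⟩
  rw [relatorIdeal, LieSubmodule.lieSpan_le]
  rintro _ ⟨i, j, hij, rfl⟩
  rw [SetLike.mem_coe, LieHom.mem_ker]
  rcases hA i j hij with h | h
  · rw [relator, h, if_pos rfl, show (1 - (-1) : ℤ).toNat = 2 from rfl, pow_two]
    simp [h1 i j hij h]
  · rw [relator, h, if_neg (by decide), show (1 - 0 : ℤ).toNat = 1 from rfl, pow_one]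
    simp [h0 i j hij h]

end Presentation

/-! ### The diagram of type D as a fork. -/

section TypeD

variable {n : ℕ}

/-- The entries of the Cartan matrix of type `D_{2n+1}`, in terms of the distances
`2 * n - 1 - i` of the nodes to the end nodes of the fork. -/
theorem cartanD_apply (hn : 1 ≤ n) {i j : Fin (2 * n + 1)} (hij : i ≠ j) :
    CartanMatrix.D (2 * n + 1) i j =
      if 2 * n - 1 - i.1 + 1 = 2 * n - 1 - j.1 ∨ 2 * n - 1 - j.1 + 1 = 2 * n - 1 - i.1
      then -1 else 0 := by
  have hij' : i.1 ≠ j.1 := fun h => hij (Fin.ext h)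
  have hi := i.2
  have hj := j.2
  -- Truncated subtraction gives both `2n - 1` and `2n` distance zero, so one adjacency condition
  -- covers the fork too.
  simp only [CartanMatrix.D, Matrix.of_apply, if_neg hij]
  split_ifs <;> first | rfl | omega

/-- The generators of the electrical Lie algebra of type `D_{2n+1}` along the chain that starts at
the end node `e_1` of the fork. -/
noncomputable def chainGen (n i : ℕ) : eD n := gen ℂ (CartanMatrix.D (2 * n + 1)) ⟨2 * n - 1 - i, by omega⟩

theorem isFork_eD (hn : 1 ≤ n) : IsFork ℂ (2 * n) (chainGen n) (eOneBar n) := by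
  have adj {i j : ℕ} (hi : i < 2 * n + 1) (hj : j < 2 * n + 1) (hij : i ≠ j)
      (h : 2 * n - 1 - i + 1 = 2 * n - 1 - j ∨ 2 * n - 1 - j + 1 = 2 * n - 1 - i) :
      ⁅gen ℂ (CartanMatrix.D (2 * n + 1)) ⟨i, hi⟩, ⁅gen ℂ (CartanMatrix.D (2 * n + 1)) ⟨i, hi⟩,
        gen ℂ (CartanMatrix.D (2 * n + 1)) ⟨j, hj⟩⁆⁆ =
        (-2 : ℂ) • gen ℂ (CartanMatrix.D (2 * n + 1)) ⟨i, hi⟩ := by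
    have hne : (⟨i, hi⟩ : Fin (2 * n + 1)) ≠ ⟨j, hj⟩ := fun h => hij (Fin.ext_iff.1 h)
    exact lie_lie_gen ℂ hne (by rw [cartanD_apply hn hne]; exact if_pos h)
  have far {i j : ℕ} (hi : i < 2 * n + 1) (hj : j < 2 * n + 1) (hij : i ≠ j)
      (h : ¬(2 * n - 1 - i + 1 = 2 * n - 1 - j ∨ 2 * n - 1 - j + 1 = 2 * n - 1 - i)) :
      ⁅gen ℂ (CartanMatrix.D (2 * n + 1)) ⟨i, hi⟩,
        gen ℂ (CartanMatrix.D (2 * n + 1)) ⟨j, hj⟩⁆ = 0 := by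
    have hne : (⟨i, hi⟩ : Fin (2 * n + 1)) ≠ ⟨j, hj⟩ := fun h => hij (Fin.ext_iff.1 h)
    exact lie_gen ℂ hne (by rw [cartanD_apply hn hne]; exact if_neg h)
  exact
    { isChain :=
        { lie_lie_succ := fun i hi => adj _ _ (by omega) (by omega)
          lie_lie_pred := fun i hi => adj _ _ (by omega) (by omega)
          lie_eq_zero := fun i j hij hj => far _ _ (by omega) (by omega) }
      lie_fork := far _ _ (by omega) (by omega)
      lie_lie_right := fun _ => adj _ _ (by omega) (by omega)
      lie_lie_left := fun _ => adj _ _ (by omega) (by omega)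
      lie_right := fun j hj hjN => far _ _ (by omega) (by omega) }

theorem lieSpan_chainGen (n : ℕ) :
    LieSubalgebra.lieSpan ℂ (eD n) (insert (eOneBar n) (chainGen n '' Set.Iio (2 * n))) = ⊤ := by
  rw [eq_top_iff, ← lieSpan_range_gen ℂ (CartanMatrix.D (2 * n + 1)), LieSubalgebra.lieSpan_le]
  rintro _ ⟨⟨i, hi⟩, rfl⟩
  apply LieSubalgebra.subset_lieSpan
  rcases Nat.lt_or_ge i (2 * n) with h | h
  · refine Or.inr ⟨2 * n - 1 - i, by simp; omega, ?_⟩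
    rw [chainGen]
    congr 2
    omega
  · left
    rw [eOneBar]
    congr 2
    omega

/-- Sending each node to the symplectic generator indexed by its distance folds the fork onto the
chain. -/
theorem exists_lieHom_sp (hn : 1 ≤ n) : ∃ φ : eD n →ₗ⁅ℂ⁆ sp (Fin n) ℂ,
    (∀ i < 2 * n, φ (chainGen n i) = spGen ℂ n i) ∧ φ (eOneBar n) = spGen ℂ n 0 := by
  have hc := isChain_spGen ℂ n
  have key := exists_lieHom ℂ (A := CartanMatrix.D (2 * n + 1))
    (fun k => spGen ℂ n (2 * n - 1 - k.1))
  obtain ⟨φ, hφ⟩ := by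
    refine key (fun i j hij h => ?_) (fun i j hij h => ?_) (fun i j hij => ?_)
    · rw [cartanD_apply hn hij] at h
      rcases Classical.em (2 * n - 1 - i.1 + 1 = 2 * n - 1 - j.1) with h1 | h1
      · rw [← h1]
        exact hc.lie_lie_succ _ (by omega)
      rcases Classical.em (2 * n - 1 - j.1 + 1 = 2 * n - 1 - i.1) with h2 | h2
      · rw [← h2]
        exact hc.lie_lie_pred _ (by omega)
      · simp [h1, h2] at h
    · have hi := i.2
      have hj := j.2
      rw [cartanD_apply hn hij] at h
      have h1 : ¬(2 * n - 1 - i.1 + 1 = 2 * n - 1 - j.1 ∨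
          2 * n - 1 - j.1 + 1 = 2 * n - 1 - i.1) := fun h' => by simp [h'] at h
      rcases lt_trichotomy (2 * n - 1 - i.1) (2 * n - 1 - j.1) with h2 | h2 | h2
      · exact hc.lie_eq_zero _ _ (by omega) (by omega)
      -- Distinct nodes at equal distance are the two fork ends, which have the same image.
      · rw [h2, lie_self]
      · exact hc.lie_eq_zero' (by omega) (by omega)
    · rw [cartanD_apply hn hij]
      split_ifs <;> simp
  refine ⟨φ, fun i hi => ?_, ?_⟩
  · rw [chainGen, hφ]
    congr 1
    simp only
    omega
  · rw [eOneBar, hφ]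
    congr 1
    simp only
    omega

theorem J_eq (n : ℕ) : J n = LieSubmodule.lieSpan ℂ (eD n) {eOneBar n - chainGen n 0} := rfl

end TypeD

end Electrical

/-- For `n ≥ 1`, the ideal `J` is solvable and is the radical of the electrical Lie algebra of type
`D` and rank `2n + 1`, and the quotient by `J` is isomorphic to the symplectic Lie algebra of
complex `2n × 2n` matrices. -/
theorem mainTheorem6 (n : ℕ) (hn : 1 ≤ n) :
    LieAlgebra.IsSolvable (Electrical.J n) ∧
    Electrical.J n = LieAlgebra.radical ℂ (Electrical.eD n) ∧
    Nonempty ((Electrical.eD n ⧸ Electrical.J n) ≃ₗ⁅ℂ⁆ LieAlgebra.Symplectic.sp (Fin n) ℂ) := by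
  have hfork := Electrical.isFork_eD hn
  have hgen := Electrical.lieSpan_chainGen n
  have hsolv : LieAlgebra.IsSolvable (Electrical.J n) :=
    hfork.isSolvable_lieSpan (by omega) hgen
  obtain ⟨φ, hφ, hφ'⟩ := Electrical.exists_lieHom_sp hn
  have hker : Electrical.J n ≤ φ.ker := by
    rw [Electrical.J_eq, LieSubmodule.lieSpan_le]
    rintro _ rfl
    rw [SetLike.mem_coe, LieHom.mem_ker, map_sub, hφ', hφ 0 (by omega), sub_self]
  let ψ := Electrical.quotientLift (Electrical.J n) φ hker
  let π : Electrical.eD n → Electrical.eD n ⧸ Electrical.J n :=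
    fun x => LieSubmodule.Quotient.mk x
  have hψ : ∀ x, ψ (π x) = φ x := fun x => rfl
  have hchain : Electrical.IsChain ℂ (2 * n) fun i => π (Electrical.chainGen n i) :=
    { lie_lie_succ := fun i hi => congrArg π (hfork.isChain.lie_lie_succ i hi)
      lie_lie_pred := fun i hi => congrArg π (hfork.isChain.lie_lie_pred i hi)
      lie_eq_zero := fun i j hij hj => congrArg π (hfork.isChain.lie_eq_zero i j hij hj) }
  have hgen' : LieSubalgebra.lieSpan ℂ (Electrical.eD n ⧸ Electrical.J n)
      ((fun i => π (Electrical.chainGen n i)) '' Set.Iio (2 * n)) = ⊤ := by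
    -- Modulo `J` the extra fork end equals the first element of the chain and is redundant as a
    -- generator.
    rw [← Electrical.lieSpan_image_mk ℂ (Electrical.J n) hgen, Set.image_insert_eq, Set.image_image,
      Set.insert_eq_of_mem]
    refine ⟨0, by simp; omega, ?_⟩
    refine ((Submodule.Quotient.eq _).2 ?_).symm
    exact LieSubmodule.subset_lieSpan rfl
  have hbij : Function.Bijective ψ :=
    Electrical.bijective_of_isChain hchain hgen' ψ fun i hi => (hψ _).trans (hφ i hi)
  have hsurj : Function.Surjective φ := by
    intro X
    obtain ⟨y, rfl⟩ := hbij.2 X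
    obtain ⟨x, rfl⟩ := Submodule.Quotient.mk_surjective _ y
    exact ⟨x, rfl⟩
  refine ⟨hsolv, Electrical.eq_radical_of_ker hsolv hsurj ?_, ⟨LieEquiv.ofBijective ψ hbij⟩⟩
  intro x hx
  rw [LieHom.mem_ker, ← hψ, ← map_zero ψ] at hx
  exact LieSubmodule.Quotient.mk_eq_zero'.1 (hbij.1 hx)
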